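/- Let $f:\mathbb{R}^n\to\mathbb{R}$ be continuously differentiable, let $\varphi:\mathbb{R}^n\to(-\infty,+\infty]$ be convex, lower semicontinuous and proper, set $\psi=f+\varphi$, and let $\Lambda\in\mathbb{R}^{n\times n}$ be symmetric positive definite, with $\|x\|_\Lambda=\sqrt{\langle x,\Lambda x\rangle}$. Define \[ \mathrm{prox}(z)=\operatorname{argmin}_{y}\ \varphi(y)+\tfrac12\|z-y\|_\Lambda^2,\qquad F_{\mathrm{nat}}(x)=x-\mathrm{prox}(x-\Lambda^{-1}\nabla f(x)),\qquad F_{\mathrm{nor}}(z)=\nabla f(\mathrm{prox}(z))+\Lambda(z-\mathrm{prox}(z)). \] Let $(\bar x,\bar z)$ be a criticality pair, i.e. $\varphi(\bar x)<\infty$, $F_{\mathrm{nat}}(\bar x)=0$, $F_{\mathrm{nor}}(\bar z)=0$ and $\bar x=\mathrm{prox}(\bar z)$. Let $f$ be twice continuously differentiable in a neighborhood of $\bar x$, and assume that $\varphi$ is twice epi-differentiable at $\bar x$ for $\alpha=-\nabla f(\bar x)$, i.e. there is $d:\mathbb{R}^n\to[-\infty,+\infty]$ such that for every $h\in\mathbb{R}^n$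 and every sequence $t_k\downarrow0$ the quotients $\Delta_t(h)=\frac{\varphi(\bar x+th)-\varphi(\bar x)-t\langle\alpha,h\rangle}{t^2/2}$ satisfy $\liminf_k\Delta_{t_k}(h^k)\ge d(h)$ for every sequence $h^k\to h$ and $\limsup_k\Delta_{t_k}(h^k)\le d(h)$ for some sequence $h^k\to h$. Then $\mathrm{prox}$ and $F_{\mathrm{nor}}$ are semidifferentiable at $\bar z$, i.e. for $F\in\{\mathrm{prox},F_{\mathrm{nor}}\}$ and every $h$ the limit $F'(\bar z;h)=\lim_{t\downarrow0,\,\tilde h\to h}\frac{F(\bar z+t\tilde h)-F(\bar z)}{t}$ exists, and the following hold. (i) If $\bar z$ is a local minimum of $\psi\circ\mathrm{prox}$, then for all $h\in\mathbb{R}^n$ \[ \max_{D\in\partial\,\mathrm{prox}(\bar z)}\langle Dh,\nabla^2f(\mathrm{prox}(\bar z))Dh+\Lambda(I-D)h\rangle\ \ge\ \langle\mathrm{prox}'(\bar z;h),F_{\mathrm{nor}}'(\bar z;h)\rangle\ \ge\ 0, \] where $\partial\,\mathrm{prox}(\bar z)$ is Clarke's generalized Jacobian and the maximum is attained. (ii)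 If there are $\sigma,\delta>0$ with $\psi(\mathrm{prox}(z))\ge\psi(\mathrm{prox}(\bar z))+\frac{\sigma}{2}\|\mathrm{prox}(z)-\mathrm{prox}(\bar z)\|_\Lambda^2$ for all $z\in B_\delta(\bar z)$, then \[ \langle\mathrm{prox}'(\bar z;h),F_{\mathrm{nor}}'(\bar z;h)\rangle>0\quad\text{for all } h \text{ with } \mathrm{prox}'(\bar z;h)\ne0. \qquad(*) \] Moreover, if $(*)$ holds, then $F_{\mathrm{nor}}$ is strongly metrically subregular at $\bar z$ for $0$ and $F_{\mathrm{nat}}$ is strongly metrically subregular at $\bar x$ for $0$; here $F$ is strongly metrically subregular at $\xi$ for $y$ if $F(\xi)=y$ and there are $\kappa>0$ and a neighborhood $U$ of $\xi$ with $\|x-\xi\|\le\kappa\|F(x)-y\|$ for all $x\in U$. -/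

import Mathlib

open Filter Topology

noncomputable section

namespace NormalMap

/-- The Euclidean space `ℝⁿ`. -/
abbrev Rn (n : ℕ) : Type := EuclideanSpace ℝ (Fin n)

/-- The linear map `x ↦ A x` on Euclidean space given by a real square matrix `A`. -/
abbrev act {n : ℕ} (A : Matrix (Fin n) (Fin n) ℝ) : Rn n →L[ℝ] Rn n :=
  Matrix.toEuclideanCLM (𝕜 := ℝ) A

/-- The norm `‖x‖_A = √⟨x, A x⟩`. -/
def wnorm {n : ℕ} (A : Matrix (Fin n) (Fin n) ℝ) (x : Rn n) : ℝ :=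
  Real.sqrt (inner ℝ x (act A x))

/-- `φ : ℝⁿ → (-∞, ∞]` is convex (its epigraph is convex), lower semicontinuous and proper. -/
structure IsConvexLscProper {n : ℕ} (φ : Rn n → EReal) : Prop where
  convex : Convex ℝ {p : Rn n × ℝ | φ p.1 ≤ (p.2 : EReal)}
  lsc : LowerSemicontinuous φ
  ne_bot : ∀ x, φ x ≠ ⊥
  exists_ne_top : ∃ x, φ x ≠ ⊤

/-- The function `y ↦ φ(y) + ½ ‖z - y‖_Λ²` whose minimizer is the proximal point of `z`. -/
def proxObjective {n : ℕ} (Λ : Matrix (Fin n) (Fin n) ℝ) (φ : Rn n → EReal)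
    (z y : Rn n) : EReal :=
  φ y + ((1 / 2 * wnorm Λ (z - y) ^ 2 : ℝ) : EReal)

/-- The proximity operator: a global minimizer of `y ↦ φ(y) + ½ ‖z - y‖_Λ²`. The minimizer exists
and is unique when `Λ` is positive definite and `φ` is convex, lower semicontinuous and proper. -/
def prox {n : ℕ} (Λ : Matrix (Fin n) (Fin n) ℝ) (φ : Rn n → EReal) (z : Rn n) : Rn n :=
  Classical.epsilon fun x => ∀ y, proxObjective Λ φ z x ≤ proxObjective Λ φ z y

/-- The objective `ψ = f + φ`. -/
def objective {n : ℕ} (f : Rn n → ℝ) (φ : Rn n → EReal) (x : Rn n) : EReal :=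
  (f x : EReal) + φ x

/-- The natural residual `F_nat(x) = x - prox(x - Λ⁻¹ ∇f(x))`. -/
def natRes {n : ℕ} (Λ : Matrix (Fin n) (Fin n) ℝ) (f : Rn n → ℝ) (φ : Rn n → EReal)
    (x : Rn n) : Rn n :=
  x - prox Λ φ (x - act Λ⁻¹ (gradient f x))

/-- The normal map `F_nor(z) = ∇f(prox(z)) + Λ (z - prox(z))`. -/
def normalMap {n : ℕ} (Λ : Matrix (Fin n) (Fin n) ℝ) (f : Rn n → ℝ) (φ : Rn n → EReal)
    (z : Rn n) : Rn n :=
  gradient f (prox Λ φ z) + act Λ (z - prox Λ φ z)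

/-- The Hessian `∇²f(x)`, as a linear map: the derivative of the gradient. -/
def hessian {n : ℕ} (f : Rn n → ℝ) (x : Rn n) : Rn n →L[ℝ] Rn n :=
  fderiv ℝ (gradient f) x

/-- `(x, z)` is a criticality pair of the problem `min f + φ`. -/
structure IsCriticalityPair {n : ℕ} (Λ : Matrix (Fin n) (Fin n) ℝ) (f : Rn n → ℝ)
    (φ : Rn n → EReal) (x z : Rn n) : Prop where
  mem_dom : φ x < ⊤
  natRes_eq_zero : natRes Λ f φ x = 0
  normalMap_eq_zero : normalMap Λ f φ z = 0
  eq_prox : x = prox Λ φ z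

/-- The second-order difference quotient
`(θ(x + t h) - θ(x) - t ⟨α, h⟩) / (t² / 2)` of an extended-real-valued function. -/
def secondQuot {n : ℕ} (θ : Rn n → EReal) (x α : Rn n) (t : ℝ) (h : Rn n) : EReal :=
  (θ (x + t • h) - θ x - ((t * inner ℝ α h : ℝ) : EReal)) / ((t ^ 2 / 2 : ℝ) : EReal)

/-- `θ` is twice epi-differentiable at `x` for `α`: the second-order difference quotients
epi-converge to some `d : ℝⁿ → [-∞, ∞]` as `t ↓ 0`. -/
def TwiceEpiDifferentiableAt {n : ℕ} (θ : Rn n → EReal) (x α : Rn n) : Prop :=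
  ∃ d : Rn n → EReal, ∀ (h : Rn n) (t : ℕ → ℝ), (∀ k, 0 < t k) → Tendsto t atTop (𝓝 0) →
    (∀ s : ℕ → Rn n, Tendsto s atTop (𝓝 h) →
      d h ≤ liminf (fun k => secondQuot θ x α (t k) (s k)) atTop) ∧
    (∃ s : ℕ → Rn n, Tendsto s atTop (𝓝 h) ∧
      limsup (fun k => secondQuot θ x α (t k) (s k)) atTop ≤ d h)

/-- `F` is semidifferentiable (directionally differentiable in the sense of Hadamard) at `x`:
`lim (F(x + t h') - F(x)) / t` exists as `t ↓ 0`, `h' → h`, for every direction `h`. -/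
def SemidifferentiableAt {n : ℕ} (F : Rn n → Rn n) (x : Rn n) : Prop :=
  ∀ h : Rn n, ∃ v : Rn n,
    Tendsto (fun p : ℝ × Rn n => p.1⁻¹ • (F (x + p.1 • p.2) - F x)) (𝓝[>] 0 ×ˢ 𝓝 h) (𝓝 v)

/-- The directional derivative `F'(x; h) = lim_{t ↓ 0} (F(x + t h) - F(x)) / t`, meaningful when
this limit exists. -/
def dirDeriv {n : ℕ} (F : Rn n → Rn n) (x h : Rn n) : Rn n :=
  limUnder (𝓝[>] (0 : ℝ)) fun t => t⁻¹ • (F (x + t • h) - F x)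

/-- Clarke's generalized Jacobian: the convex hull of all limits of derivatives of `F` along
sequences of points of differentiability converging to `x`. -/
def clarkeJacobian {n : ℕ} (F : Rn n → Rn n) (x : Rn n) : Set (Rn n →L[ℝ] Rn n) :=
  convexHull ℝ {D | ∃ s : ℕ → Rn n, Tendsto s atTop (𝓝 x) ∧
    (∀ k, DifferentiableAt ℝ F (s k)) ∧ Tendsto (fun k => fderiv ℝ F (s k)) atTop (𝓝 D)}

/-- Strong metric subregularity of a (single-valued) mapping `F` at `ξ` for `y`. -/
def StronglyMetricallySubregularAt {n : ℕ} (F : Rn n → Rn n) (ξ y : Rn n) : Prop :=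
  F ξ = y ∧ ∃ κ > (0 : ℝ), ∃ U ∈ 𝓝 ξ, ∀ x ∈ U, ‖x - ξ‖ ≤ κ * dist y (F x)

end NormalMap

end

open NormalMap

/-! Write x = prox(z) and H = ∇²f(x) at the critical point, so that Λ(z - x) = -∇f(x) = α is a
subgradient of φ at x. The driving observation (`secondQuot_proxQuot_le`) is that the difference
quotient of prox at z in direction h is itself the proximal point of h for half the second-order
quotient of φ. Epi-convergence passes the variational inequality to the limit: every cluster point v
of these quotients satisfies d(v) + 2⟨Λ(h - v), w - v⟩ ≤ d(w) for all w. Such a v is unique, and the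
quotients are bounded because prox is Lipschitz, so prox is semidifferentiable with prox'(z; h) = v;
the chain rule gives F_nor'(z; h) = Hv + Λ(h - v).

Since d is homogeneous of degree two, testing the inequality along the ray through v yields d(v) =
⟨Λ(h - v), v⟩ (`eq_inner`). Hence ⟨prox', F_nor'⟩ = ⟨v, Hv⟩ + d(v), the second-order epi-derivative
of ψ at v, and a Taylor expansion of f turns growth of ψ ∘ prox into a lower bound for it
(`mul_inner_le_of_growth`, with σ = 0 for a local minimum). The bound by the maximum holds because v
= Dh for some D in the Clarke Jacobian, obtained by separation and Rademacher's theorem.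

If strong subregularity fails, some unit direction h annihilates the directional derivative of the
residual, which contradicts (*). -/

/-! ### Compact convex hulls, and Lipschitz maps along lines. -/

/-- By Carathéodory, at most dim E + 1 points suffice for each convex combination, so the hull is a
finite union of continuous images of compact sets. -/
theorem IsCompact.convexHull_of_finiteDimensional {E : Type*} [NormedAddCommGroup E]
    [NormedSpace ℝ E] [FiniteDimensional ℝ E] {s : Set E} (hs : IsCompact s) :
    IsCompact (convexHull ℝ s) := by
  have key : convexHull ℝ s = ⋃ N ∈ Finset.range (Module.finrank ℝ E + 2),
      (fun p : (Fin N → ℝ) × (Fin N → E) => ∑ i, p.1 i • p.2 i) ''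
        (stdSimplex ℝ (Fin N) ×ˢ Set.univ.pi fun _ => s) := by
    ext x
    simp only [Set.mem_iUnion, Set.mem_image, Prod.exists, Finset.mem_range, Set.mem_prod,
      Set.mem_univ_pi]
    constructor
    · intro hx
      obtain ⟨ι, _, z, w, hz, hind, hpos, hsum, hx⟩ := eq_pos_convex_span_of_mem_convexHull hx
      have hcard : Fintype.card ι < Module.finrank ℝ E + 2 := by
        have := hind.card_le_finrank_succ
        have := Submodule.finrank_le (vectorSpan ℝ (Set.range z))
        omega
      let e := Fintype.equivFin ι
      refine ⟨Fintype.card ι, hcard, w ∘ e.symm, z ∘ e.symm, ⟨⟨fun i => (hpos _).le, ?_⟩, ?_⟩, ?_⟩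
      · rw [← hsum]; exact e.symm.sum_comp w
      · exact fun i => hz ⟨_, rfl⟩
      · rw [← hx]; exact e.symm.sum_comp (fun i => w i • z i)
    · rintro ⟨N, -, w, z, ⟨hw, hz⟩, rfl⟩
      exact (convex_convexHull ℝ s).sum_mem (fun i _ => hw.1 i) hw.2
        fun i _ => subset_convexHull ℝ s (hz i)
  rw [key]
  refine (Finset.range _).isCompact_biUnion fun N _ => ?_
  exact ((isCompact_stdSimplex ℝ _).prod (isCompact_univ_pi fun _ => hs)).image (by fun_prop)

/-- A Lipschitz function on an interval whose derivative is a.e. at most `u` grows at most with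
slope `u`. -/
theorem LipschitzWith.sub_le_of_ae_deriv_le {g : ℝ → ℝ} {K : NNReal} (hg : LipschitzWith K g)
    {t u : ℝ} (ht : 0 ≤ t) (h : ∀ᵐ s : ℝ, s ∈ Set.Icc 0 t → deriv g s ≤ u) :
    g t - g 0 ≤ u * t := by
  have hac := (hg.lipschitzOnWith (s := Set.uIcc 0 t)).absolutelyContinuousOnInterval
  rw [← hac.integral_deriv_eq_sub]
  have : ∫ s in (0 : ℝ)..t, deriv g s ≤ ∫ _s in (0 : ℝ)..t, u := by
    refine intervalIntegral.integral_mono_ae_restrict ht hac.intervalIntegrable_deriv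
      intervalIntegrable_const ?_
    exact (MeasureTheory.ae_restrict_iff' measurableSet_Icc).2 h
  simpa [mul_comm] using this

/-- For almost every base point, a Lipschitz map is differentiable almost everywhere along a given
direction. -/
theorem LipschitzWith.ae_ae_differentiableAt_add_smul {n : ℕ} {F : Rn n → Rn n} {K : NNReal}
    (hF : LipschitzWith K F) (h : Rn n) :
    ∀ᵐ y : Rn n, ∀ᵐ s : ℝ, DifferentiableAt ℝ F (y + s • h) := by
  have hm : MeasurableSet {p : Rn n × ℝ | DifferentiableAt ℝ F (p.1 + p.2 • h)} := by
    have hc : Measurable fun p : Rn n × ℝ => p.1 + p.2 • h := by fun_prop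
    exact hc (measurableSet_of_differentiableAt ℝ F)
  -- Fubini reduces to a fixed s, where translation by s • h preserves null sets and Rademacher's
  -- theorem applies.
  rw [MeasureTheory.Measure.ae_ae_comm hm]
  refine Eventually.of_forall fun s => ?_
  exact (MeasureTheory.measurePreserving_add_right MeasureTheory.volume
    (s • h)).quasiMeasurePreserving.ae hF.ae_differentiableAt

/-! ### Directional derivatives and Clarke's generalized Jacobian. -/

namespace NormalMap

variable {n : ℕ} {F : Rn n → Rn n} {K : NNReal}

/-- The set of limits of derivatives of `F` along sequences converging to `x`. -/
def limitingJacobian (F : Rn n → Rn n) (x : Rn n) : Set (Rn n →L[ℝ] Rn n) :=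
  {D | ∃ s : ℕ → Rn n, Tendsto s atTop (𝓝 x) ∧
    (∀ k, DifferentiableAt ℝ F (s k)) ∧ Tendsto (fun k => fderiv ℝ F (s k)) atTop (𝓝 D)}

/-- Expresses the limiting Jacobian as a slice of the closure of the graph of the derivative, which
makes it closed. -/
theorem mem_limitingJacobian_iff {x : Rn n} {D : Rn n →L[ℝ] Rn n} :
    D ∈ limitingJacobian F x ↔
      (x, D) ∈ closure {p : Rn n × (Rn n →L[ℝ] Rn n) |
        DifferentiableAt ℝ F p.1 ∧ fderiv ℝ F p.1 = p.2} := by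
  rw [mem_closure_iff_seq_limit]
  constructor
  · rintro ⟨s, h1, h2, h3⟩
    exact ⟨fun k => (s k, fderiv ℝ F (s k)), fun k => ⟨h2 k, rfl⟩, h1.prodMk_nhds h3⟩
  · rintro ⟨p, hp, hlim⟩
    refine ⟨fun k => (p k).1, (continuous_fst.tendsto _).comp hlim, fun k => (hp k).1, ?_⟩
    have := (continuous_snd.tendsto _).comp hlim
    simpa only [Function.comp_def, (hp _).2] using this

theorem isCompact_limitingJacobian (hF : LipschitzWith K F) (x : Rn n) :
    IsCompact (limitingJacobian F x) := by
  refine (isCompact_closedBall (0 : Rn n →L[ℝ] Rn n) K).of_isClosed_subset ?_ ?_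
  · have : limitingJacobian F x = (fun D => (x, D)) ⁻¹' closure {p : Rn n × (Rn n →L[ℝ] Rn n) |
        DifferentiableAt ℝ F p.1 ∧ fderiv ℝ F p.1 = p.2} := by
      ext D; exact mem_limitingJacobian_iff
    rw [this]
    exact isClosed_closure.preimage (by fun_prop)
  · rintro D ⟨s, -, -, h⟩
    rw [mem_closedBall_zero_iff]
    exact le_of_tendsto' h.norm fun k => norm_fderiv_le_of_lipschitz ℝ hF

theorem isCompact_clarkeJacobian (hF : LipschitzWith K F) (x : Rn n) :
    IsCompact (clarkeJacobian F x) :=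
  (isCompact_limitingJacobian hF x).convexHull_of_finiteDimensional

/-- Upper semicontinuity of the derivative with respect to the limiting Jacobian. -/
theorem exists_ball_fderiv_lt (hF : LipschitzWith K F) (x h : Rn n) (l : Rn n →L[ℝ] ℝ) {u : ℝ}
    (hu : ∀ D ∈ limitingJacobian F x, l (D h) < u) :
    ∃ ε > 0, ∀ y ∈ Metric.ball x ε, DifferentiableAt ℝ F y → l (fderiv ℝ F y h) < u := by
  by_contra! hcon
  choose y hy hd hl using fun k : ℕ => hcon (1 / ((k : ℝ) + 1)) (by positivity)
  have hylim : Tendsto y atTop (𝓝 x) := by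
    rw [tendsto_iff_dist_tendsto_zero]
    exact squeeze_zero (fun _ => dist_nonneg) (fun k => (hy k).le)
      tendsto_one_div_add_atTop_nhds_zero_nat
  obtain ⟨D, -, ψ, hψ, hD⟩ := (isCompact_closedBall (0 : Rn n →L[ℝ] Rn n) K).tendsto_subseq
    (x := fun k => fderiv ℝ F (y k))
    (fun k => mem_closedBall_zero_iff.2 (norm_fderiv_le_of_lipschitz ℝ hF))
  refine (hu D ⟨y ∘ ψ, hylim.comp hψ.tendsto_atTop, fun k => hd _, hD⟩).not_ge ?_
  have hc : Continuous fun D : Rn n →L[ℝ] Rn n => l (D h) := by fun_prop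
  exact ge_of_tendsto' ((hc.tendsto D).comp hD) fun k => hl _

/-- A mean value inequality that needs the derivative bound only at points of differentiability near
x. -/
theorem apply_sub_le_of_fderiv_le (hF : LipschitzWith K F) {x h : Rn n} (l : Rn n →L[ℝ] ℝ)
    {u ε t : ℝ} (hu : ∀ y ∈ Metric.ball x ε, DifferentiableAt ℝ F y → l (fderiv ℝ F y h) ≤ u)
    (ht : 0 ≤ t) (hε : t * ‖h‖ < ε) :
    l (F (x + t • h) - F x) ≤ u * t := by
  -- The particular line through x may consist of points of non-differentiability, so the bound is
  -- first integrated along lines through almost every y. The radius ε - t‖h‖ keeps the whole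
  -- segment inside the ball of radius ε.
  have hae : ∀ᵐ y : Rn n, y ∈ Metric.ball x (ε - t * ‖h‖) → l (F (y + t • h) - F y) ≤ u * t := by
    filter_upwards [hF.ae_ae_differentiableAt_add_smul h] with y hy hyb
    have hg : LipschitzWith (‖l‖₊ * (K * ‖h‖₊)) fun s : ℝ => l (F (y + s • h)) := by
      refine l.lipschitz.comp (hF.comp ?_)
      refine LipschitzWith.of_dist_le_mul fun a b => ?_
      rw [dist_add_left, dist_eq_norm, ← sub_smul, norm_smul, mul_comm]; rfl
    have := hg.sub_le_of_ae_deriv_le ht (u := u) (by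
      filter_upwards [hy] with s hs hst
      have hd : HasDerivAt (fun s : ℝ => y + s • h) h s := by
        simpa using ((hasDerivAt_id s).smul_const h).const_add y
      have := (l.hasFDerivAt.comp_hasDerivAt s (hs.hasFDerivAt.comp_hasDerivAt s hd)).deriv
      have h2 : deriv (fun s : ℝ => l (F (y + s • h))) s = l (fderiv ℝ F (y + s • h) h) := this
      rw [h2]
      refine hu _ ?_ hs
      rw [Metric.mem_ball, dist_eq_norm] at hyb ⊢
      have : ‖y + s • h - x‖ ≤ ‖y - x‖ + s * ‖h‖ := by
        have := norm_add_le (y - x) (s • h)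
        rwa [norm_smul, Real.norm_of_nonneg hst.1, ← add_sub_right_comm] at this
      nlinarith [norm_nonneg h, hst.2])
    simpa using this
  have hcl : IsClosed {y : Rn n | l (F (y + t • h) - F y) ≤ u * t} := by
    have := hF.continuous
    exact isClosed_le (by fun_prop) continuous_const
  -- The violating set is open; if it contained x it would meet the ball in positive measure.
  by_contra hx
  have hopen : IsOpen ({y : Rn n | l (F (y + t • h) - F y) ≤ u * t}ᶜ ∩
      Metric.ball x (ε - t * ‖h‖)) := hcl.isOpen_compl.inter Metric.isOpen_ball
  have hpos := hopen.measure_pos MeasureTheory.volume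
    ⟨x, hx, Metric.mem_ball_self (by linarith)⟩
  refine hpos.ne' (MeasureTheory.measure_mono_null ?_ (MeasureTheory.ae_iff.1 hae))
  rintro y ⟨h1, h2⟩ h3
  exact h1 (h3 h2)

/-- A limit of difference quotients in direction `h` is the value at `h` of an element of Clarke's
generalized Jacobian. -/
theorem exists_mem_clarkeJacobian_apply_eq (hF : LipschitzWith K F) {x h v : Rn n}
    (hv : Tendsto (fun t : ℝ => t⁻¹ • (F (x + t • h) - F x)) (𝓝[>] 0) (𝓝 v)) :
    ∃ D ∈ clarkeJacobian F x, D h = v := by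
  let ev : (Rn n →L[ℝ] Rn n) →L[ℝ] Rn n := ContinuousLinearMap.apply ℝ (Rn n) h
  by_contra! hcon
  -- If v is not some Dh, a functional l separates it strictly from the compact convex set of all
  -- Dh; near x the slopes of l ∘ F in direction h are then below u, while the limit v has l v > u.
  obtain ⟨l, u, hlt, hlv⟩ := geometric_hahn_banach_closed_point
    (s := ev '' clarkeJacobian F x) (x := v)
    ((convex_convexHull ℝ _).linear_image ev.toLinearMap)
    ((isCompact_clarkeJacobian hF x).image ev.continuous).isClosed
    (by rintro ⟨D, hD, hDv⟩; exact hcon D hD hDv)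
  obtain ⟨ε, hε, hball⟩ := exists_ball_fderiv_lt hF x h l (u := u)
    fun D hD => hlt _ ⟨D, subset_convexHull ℝ _ hD, rfl⟩
  have hev : ∀ᶠ t : ℝ in 𝓝[>] 0, t * ‖h‖ < ε := by
    have : Tendsto (fun t : ℝ => t * ‖h‖) (𝓝[>] 0) (𝓝 (0 * ‖h‖)) :=
      (tendsto_nhdsWithin_of_tendsto_nhds tendsto_id).mul_const _
    exact this.eventually_lt_const (by simpa using hε)
  refine hlv.not_ge (le_of_tendsto ((l.continuous.tendsto v).comp hv) ?_)
  filter_upwards [hev, self_mem_nhdsWithin] with t ht ht0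
  have ht0 : 0 < t := ht0
  have := apply_sub_le_of_fderiv_le hF l (fun y hy hd => (hball y hy hd).le) ht0.le ht
  simp only [Function.comp_apply, map_smul, smul_eq_mul]
  rw [inv_mul_le_iff₀ ht0, mul_comm]
  exact this

end NormalMap

/-! ### The weighted inner product and the proximity operator. -/

namespace NormalMap

variable {n : ℕ} {Λ : Matrix (Fin n) (Fin n) ℝ} {φ : Rn n → EReal}

theorem inner_act_comm (hΛ : Λ.PosDef) (x y : Rn n) :
    inner ℝ (act Λ x) y = inner ℝ x (act Λ y) := by
  have h : Λ.transpose = Λ := by simpa using hΛ.isHermitian.eq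
  rw [real_inner_comm, Matrix.inner_toEuclideanCLM, Matrix.inner_toEuclideanCLM,
    Matrix.dotProduct_mulVec, ← Matrix.mulVec_transpose, h, dotProduct_comm]

theorem inner_act_self_pos (hΛ : Λ.PosDef) {x : Rn n} (hx : x ≠ 0) :
    0 < inner ℝ x (act Λ x) := by
  rw [Matrix.inner_toEuclideanCLM]
  have := hΛ.dotProduct_mulVec_pos (x := x.ofLp) (by simpa using hx)
  simpa using this

theorem inner_act_self_nonneg (hΛ : Λ.PosDef) (x : Rn n) : 0 ≤ inner ℝ x (act Λ x) := by
  rcases eq_or_ne x 0 with rfl | hx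
  · simp
  · exact (inner_act_self_pos hΛ hx).le

theorem exists_coercive (hΛ : Λ.PosDef) :
    ∃ c > 0, ∀ x : Rn n, c * ‖x‖ ^ 2 ≤ inner ℝ x (act Λ x) := by
  rcases (Metric.sphere (0 : Rn n) 1).eq_empty_or_nonempty with he | hne
  · refine ⟨1, one_pos, fun x => ?_⟩
    rcases eq_or_ne x 0 with rfl | hx
    · simp
    · have : ‖x‖⁻¹ • x ∈ Metric.sphere (0 : Rn n) 1 := by
        simp [norm_smul, inv_mul_cancel₀ (norm_ne_zero_iff.2 hx)]
      simp [he] at this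
  · obtain ⟨x₀, hx₀, hmin⟩ := (isCompact_sphere (0 : Rn n) 1).exists_isMinOn hne
      (f := fun x => inner ℝ x (act Λ x)) (by fun_prop)
    have hx₀' : x₀ ≠ 0 := by
      rintro rfl; simp at hx₀
    refine ⟨_, inner_act_self_pos hΛ hx₀', fun x => ?_⟩
    rcases eq_or_ne x 0 with rfl | hx
    · simp
    · have hn : 0 < ‖x‖ := norm_pos_iff.2 hx
      have hmem : ‖x‖⁻¹ • x ∈ Metric.sphere (0 : Rn n) 1 := by
        simp [norm_smul, inv_mul_cancel₀ hn.ne']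
      have h := hmin hmem
      simp only [Set.mem_ofPred_eq, map_smul, real_inner_smul_left, real_inner_smul_right] at h
      calc inner ℝ x₀ (act Λ x₀) * ‖x‖ ^ 2
          ≤ (‖x‖⁻¹ * (‖x‖⁻¹ * inner ℝ x (act Λ x))) * ‖x‖ ^ 2 := by gcongr
        _ = inner ℝ x (act Λ x) := by field_simp

theorem wnorm_sq (hΛ : Λ.PosDef) (x : Rn n) : wnorm Λ x ^ 2 = inner ℝ x (act Λ x) :=
  Real.sq_sqrt (inner_act_self_nonneg hΛ x)

theorem act_inv_act (hΛ : Λ.PosDef) (x : Rn n) : act Λ⁻¹ (act Λ x) = x := by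
  rw [← mul_apply_eq_comp, ← map_mul,
    Matrix.nonsing_inv_mul _ ((Matrix.isUnit_iff_isUnit_det _).1 hΛ.isUnit), map_one]
  rfl

theorem act_act_inv (hΛ : Λ.PosDef) (x : Rn n) : act Λ (act Λ⁻¹ x) = x := by
  rw [← mul_apply_eq_comp, ← map_mul,
    Matrix.mul_nonsing_inv _ ((Matrix.isUnit_iff_isUnit_det _).1 hΛ.isUnit), map_one]
  rfl

theorem inner_act_sub_smul (hΛ : Λ.PosDef) (x y : Rn n) (t : ℝ) :
    inner ℝ (x - t • y) (act Λ (x - t • y)) =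
      inner ℝ x (act Λ x) - 2 * t * inner ℝ (act Λ x) y + t ^ 2 * inner ℝ y (act Λ y) := by
  have h := inner_act_comm hΛ x y
  have h2 : inner ℝ y (act Λ x) = inner ℝ (act Λ x) y := real_inner_comm _ _
  simp only [map_sub, map_smul, inner_sub_left, inner_sub_right, real_inner_smul_left,
    real_inner_smul_right]
  rw [← h, h2]; ring

namespace IsConvexLscProper

theorem exists_coe_eq (hφ : IsConvexLscProper φ) {x : Rn n} (hx : φ x ≠ ⊤) :
    ∃ a : ℝ, φ x = a :=
  ⟨(φ x).toReal, (EReal.coe_toReal hx (hφ.ne_bot x)).symm⟩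

theorem le_on_segment (hφ : IsConvexLscProper φ) {x y : Rn n} {a b : ℝ} (hx : φ x = a)
    (hy : φ y = b) {t : ℝ} (h0 : 0 ≤ t) (h1 : t ≤ 1) :
    φ (x + t • (y - x)) ≤ ((a + t * (b - a) : ℝ) : EReal) := by
  have := hφ.convex (x := (x, a)) (y := (y, b)) (by simp [hx]) (by simp [hy])
    (sub_nonneg.2 h1) h0 (by ring)
  simp only [Set.mem_ofPred_eq, Prod.smul_mk, Prod.mk_add_mk, smul_eq_mul] at this
  convert this using 2
  · module
  · ring_nf

/-- A proper convex lower semicontinuous function is minorized by a function of linear growth. -/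
theorem exists_linear_minorant (hφ : IsConvexLscProper φ) :
    ∃ C : ℝ, 0 ≤ C ∧ ∀ x, ((-(C * (1 + ‖x‖)) : ℝ) : EReal) ≤ φ x := by
  obtain ⟨x₀, hx₀⟩ := hφ.exists_ne_top
  obtain ⟨a, ha⟩ := hφ.exists_coe_eq hx₀
  obtain ⟨m, -, hm⟩ := (hφ.lsc.lowerSemicontinuousOn _).exists_isMinOn
    ⟨x₀, Metric.mem_closedBall_self zero_le_one⟩ (isCompact_closedBall x₀ 1)
  have hm' : φ m ≤ φ x₀ := hm (Metric.mem_closedBall_self zero_le_one)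
  obtain ⟨M, hM⟩ := hφ.exists_coe_eq (ne_top_of_le_ne_top hx₀ hm')
  -- The natural bound is in terms of 1 + ‖y - x₀‖, which is at most (1 + ‖x₀‖)(1 + ‖y‖).
  refine ⟨(|M| + |a|) * (1 + ‖x₀‖), by positivity, fun y => ?_⟩
  rcases eq_or_ne (φ y) ⊤ with hy | hy
  · simp [hy]
  obtain ⟨b, hb⟩ := hφ.exists_coe_eq hy
  have hle : ∀ u ∈ Metric.closedBall x₀ 1, (M : EReal) ≤ φ u := fun u hu => hM ▸ hm hu
  rw [hb, EReal.coe_le_coe_iff]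
  have hr : ‖y - x₀‖ ≤ ‖y‖ + ‖x₀‖ := norm_sub_le _ _
  have hMa : 0 ≤ |M| + |a| := by positivity
  have key : -((|M| + |a|) * (1 + ‖y - x₀‖)) ≤ b := by
    rcases le_or_gt ‖y - x₀‖ 1 with h1 | h1
    · have := hle y (by rwa [mem_closedBall_iff_norm])
      rw [hb, EReal.coe_le_coe_iff] at this
      nlinarith [neg_abs_le M, abs_nonneg a, norm_nonneg (y - x₀)]
    · have hr0 : 0 < ‖y - x₀‖ := by linarith
      -- Far from x₀, convexity is applied at the point of the segment at distance one from x₀,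
      -- where φ ≥ M.
      have h2 := hφ.le_on_segment ha hb (inv_nonneg.2 hr0.le) (inv_le_one_of_one_le₀ h1.le)
      have h3 := (hle (x₀ + ‖y - x₀‖⁻¹ • (y - x₀)) (by
        rw [mem_closedBall_iff_norm, add_sub_cancel_left, norm_smul, norm_inv, norm_norm,
          inv_mul_cancel₀ hr0.ne'])).trans h2
      rw [EReal.coe_le_coe_iff] at h3
      have h4 : ‖y - x₀‖ * M ≤ ‖y - x₀‖ * a + (b - a) := by
        calc ‖y - x₀‖ * M ≤ ‖y - x₀‖ * (a + ‖y - x₀‖⁻¹ * (b - a)) := by gcongr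
          _ = _ := by field_simp
      nlinarith [neg_abs_le M, le_abs_self a, abs_nonneg M, abs_nonneg a]
  refine le_trans (neg_le_neg ?_) key
  nlinarith [mul_nonneg hMa (mul_nonneg (norm_nonneg x₀) (norm_nonneg y)),
    mul_le_mul_of_nonneg_left hr hMa]

/-- The quadratic term dominates the linear minorant of φ, so sublevel sets are bounded and lower
semicontinuity on a closed ball suffices. -/
theorem exists_minimizer (hφ : IsConvexLscProper φ) (hΛ : Λ.PosDef) (z : Rn n) :
    ∃ x, ∀ y, proxObjective Λ φ z x ≤ proxObjective Λ φ z y := by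
  obtain ⟨C, hC, hlin⟩ := hφ.exists_linear_minorant
  obtain ⟨c, hc, hcoer⟩ := exists_coercive hΛ
  obtain ⟨x₀, hx₀⟩ := hφ.exists_ne_top
  obtain ⟨a, ha⟩ := hφ.exists_coe_eq hx₀
  set J := proxObjective Λ φ z with hJ
  set J₀ : ℝ := a + 1 / 2 * wnorm Λ (z - x₀) ^ 2 with hJ₀
  have hJx₀ : J x₀ = (J₀ : EReal) := by
    simp only [hJ, proxObjective, ha, hJ₀, EReal.coe_add]
  set A : ℝ := |J₀| + C * (1 + ‖z‖) with hA
  have hA0 : 0 ≤ A := by positivity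
  -- For r > R one has c r² / 2 > A + C r, which contradicts membership in the sublevel set of x₀.
  set R : ℝ := 2 * (A + C) / c + 1 with hR
  have hR1 : 1 ≤ R := by
    have : 0 ≤ 2 * (A + C) / c := by positivity
    linarith
  have hsub : ∀ y, J y ≤ (J₀ : EReal) → y ∈ Metric.closedBall z R := by
    intro y hy
    have hyt : φ y ≠ ⊤ := by
      intro h
      rw [hJ, proxObjective, h, EReal.top_add_coe] at hy
      exact EReal.coe_ne_top _ (top_le_iff.1 hy)
    obtain ⟨b, hb⟩ := hφ.exists_coe_eq hyt
    have h1 : -(C * (1 + ‖y‖)) ≤ b := by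
      have := hlin y
      rwa [hb, EReal.coe_le_coe_iff] at this
    have h2 : b + 1 / 2 * inner ℝ (z - y) (act Λ (z - y)) ≤ J₀ := by
      rw [← wnorm_sq hΛ]
      simp only [hJ, proxObjective, hb] at hy
      exact_mod_cast hy
    have h3 := hcoer (z - y)
    have h4 : ‖y‖ ≤ ‖z‖ + ‖z - y‖ := by
      have := norm_sub_le z (z - y)
      rwa [sub_sub_cancel] at this
    rw [mem_closedBall_iff_norm']
    by_contra! hlt
    have h5 : 2 * (A + C) + c ≤ c * ‖z - y‖ := by
      calc 2 * (A + C) + c = c * R := by rw [hR]; field_simp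
        _ ≤ c * ‖z - y‖ := by gcongr
    nlinarith [le_abs_self J₀, mul_le_mul_of_nonneg_left h4 hC, norm_nonneg (z - y)]
  have hlsc : LowerSemicontinuous J := by
    refine hφ.lsc.add' ?_ fun x => ?_
    · refine Continuous.lowerSemicontinuous ?_
      refine continuous_coe_real_ereal.comp ?_
      simp only [wnorm_sq hΛ]
      fun_prop
    · exact EReal.continuousAt_add (Or.inr (EReal.coe_ne_bot _)) (Or.inr (EReal.coe_ne_top _))
  obtain ⟨p, -, hp⟩ := (hlsc.lowerSemicontinuousOn _).exists_isMinOn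
    ⟨x₀, hsub x₀ hJx₀.le⟩ (isCompact_closedBall z R)
  refine ⟨p, fun y => ?_⟩
  rcases le_or_gt (J y) J₀ with h | h
  · exact hp (hsub y h)
  · exact (hp (hsub x₀ hJx₀.le)).trans (hJx₀.le.trans h.le)

theorem proxObjective_prox_le (hφ : IsConvexLscProper φ) (hΛ : Λ.PosDef) (z y : Rn n) :
    proxObjective Λ φ z (prox Λ φ z) ≤ proxObjective Λ φ z y :=
  Classical.epsilon_spec (hφ.exists_minimizer hΛ z) y

theorem prox_ne_top (hφ : IsConvexLscProper φ) (hΛ : Λ.PosDef) (z : Rn n) :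
    φ (prox Λ φ z) ≠ ⊤ := by
  intro h
  obtain ⟨x₀, hx₀⟩ := hφ.exists_ne_top
  obtain ⟨a, ha⟩ := hφ.exists_coe_eq hx₀
  have := hφ.proxObjective_prox_le hΛ z x₀
  rw [proxObjective, proxObjective, h, ha, EReal.top_add_coe, ← EReal.coe_add] at this
  exact (EReal.coe_ne_top _) (top_le_iff.1 this)

/-- `Λ (z - prox z)` is a subgradient of `φ` at `prox z`. -/
theorem prox_subgradient (hφ : IsConvexLscProper φ) (hΛ : Λ.PosDef) {z y : Rn n} {a b : ℝ}
    (ha : φ (prox Λ φ z) = a) (hb : φ y = b) :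
    a + inner ℝ (act Λ (z - prox Λ φ z)) (y - prox Λ φ z) ≤ b := by
  set p := prox Λ φ z with hp
  -- Compare the minimizer p with p + t(y - p), divide by t, and let t ↓ 0 to remove the quadratic
  -- term.
  have key : ∀ t : ℝ, 0 < t → t ≤ 1 →
      a + inner ℝ (act Λ (z - p)) (y - p) ≤
        b + t * (1 / 2 * inner ℝ (y - p) (act Λ (y - p))) := by
    intro t ht ht1
    have h1 := hφ.proxObjective_prox_le hΛ z (p + t • (y - p))
    have h2 := hφ.le_on_segment ha hb ht.le ht1
    rw [← hp] at h1
    simp only [proxObjective, wnorm_sq hΛ] at h1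
    have h3 := h1.trans (add_le_add_left h2 _)
    rw [ha, ← sub_sub, inner_act_sub_smul hΛ] at h3
    norm_cast at h3
    have h4 : t * (a + inner ℝ (act Λ (z - p)) (y - p)) ≤
        t * (b + t * (1 / 2 * inner ℝ (y - p) (act Λ (y - p)))) := by nlinarith
    exact le_of_mul_le_mul_left h4 ht
  have hlim : Tendsto (fun t : ℝ => b + t * (1 / 2 * inner ℝ (y - p) (act Λ (y - p))))
      (𝓝[>] 0) (𝓝 (b + 0 * (1 / 2 * inner ℝ (y - p) (act Λ (y - p))))) :=
    ((tendsto_nhdsWithin_of_tendsto_nhds tendsto_id).mul_const _).const_add _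
  rw [zero_mul, add_zero] at hlim
  refine ge_of_tendsto hlim ?_
  filter_upwards [Ioc_mem_nhdsGT (zero_lt_one' ℝ)] with t ht using key t ht.1 ht.2

/-- Adding the subgradient inequalities at two points shows that prox is firmly nonexpansive in the
Λ-inner product; coercivity converts this to the Euclidean norm. -/
theorem exists_lipschitzWith_prox (hφ : IsConvexLscProper φ) (hΛ : Λ.PosDef) :
    ∃ K, LipschitzWith K (prox Λ φ) := by
  obtain ⟨c, hc, hcoer⟩ := exists_coercive hΛ
  refine ⟨‖act Λ‖₊ / ⟨c, hc.le⟩, LipschitzWith.of_dist_le_mul fun z w => ?_⟩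
  obtain ⟨a, ha⟩ := hφ.exists_coe_eq (hφ.prox_ne_top hΛ z)
  obtain ⟨b, hb⟩ := hφ.exists_coe_eq (hφ.prox_ne_top hΛ w)
  have h1 := hφ.prox_subgradient hΛ ha hb
  have h2 := hφ.prox_subgradient hΛ hb ha
  set p := prox Λ φ z
  set r := prox Λ φ w
  have h3 : inner ℝ (p - r) (act Λ (p - r)) ≤ inner ℝ (act Λ (z - w)) (p - r) := by
    rw [← inner_act_comm hΛ]
    have e : act Λ (z - w) = act Λ (z - p) - act Λ (w - r) + act Λ (p - r) := by
      simp only [map_sub]; abel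
    rw [e, inner_add_left, inner_sub_left]
    rw [← neg_sub p r, inner_neg_right] at h1
    linarith
  have h4 : inner ℝ (act Λ (z - w)) (p - r) ≤ ‖act Λ‖ * ‖z - w‖ * ‖p - r‖ :=
    (real_inner_le_norm _ _).trans (by gcongr; exact (act Λ).le_opNorm _)
  have h5 := hcoer (p - r)
  rw [dist_eq_norm, dist_eq_norm]
  change ‖p - r‖ ≤ ‖act Λ‖ / c * ‖z - w‖
  rw [div_mul_eq_mul_div, le_div_iff₀ hc]
  rcases (norm_nonneg (p - r)).eq_or_lt with h0 | h0
  · rw [← h0, zero_mul]; positivity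
  · refine le_of_mul_le_mul_right ?_ h0
    nlinarith

end IsConvexLscProper

end NormalMap

/-! ### Second-order epi-derivatives and semidifferentiability of prox. -/

namespace NormalMap

variable {n : ℕ} {Λ : Matrix (Fin n) (Fin n) ℝ} {φ : Rn n → EReal}

theorem secondQuot_coe {θ : Rn n → EReal} {x α h : Rn n} {t a b : ℝ} (ha : θ x = a)
    (hb : θ (x + t • h) = b) :
    secondQuot θ x α t h = (((b - a - t * inner ℝ α h) / (t ^ 2 / 2) : ℝ) : EReal) := by
  rw [secondQuot, ha, hb]
  norm_cast

theorem secondQuot_top {θ : Rn n → EReal} {x α h : Rn n} {t a : ℝ} (ha : θ x = a) (ht : 0 < t)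
    (hb : θ (x + t • h) = ⊤) : secondQuot θ x α t h = ⊤ := by
  rw [secondQuot, ha, hb, EReal.top_sub_coe, EReal.top_sub_coe]
  exact EReal.top_div_of_pos_ne_top (by exact_mod_cast (by positivity : 0 < t ^ 2 / 2))
    (EReal.coe_ne_top _)

/-- `d` is the second-order epi-derivative of `θ` at `x` for `α`. -/
def IsSecondEpiDerivative (θ : Rn n → EReal) (x α : Rn n) (d : Rn n → EReal) : Prop :=
  ∀ (h : Rn n) (t : ℕ → ℝ), (∀ k, 0 < t k) → Tendsto t atTop (𝓝 0) →
    (∀ s : ℕ → Rn n, Tendsto s atTop (𝓝 h) →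
      d h ≤ liminf (fun k => secondQuot θ x α (t k) (s k)) atTop) ∧
    (∃ s : ℕ → Rn n, Tendsto s atTop (𝓝 h) ∧
      limsup (fun k => secondQuot θ x α (t k) (s k)) atTop ≤ d h)

/-- The difference quotient of the proximity operator. -/
noncomputable def proxQuot (Λ : Matrix (Fin n) (Fin n) ℝ) (φ : Rn n → EReal) (z : Rn n) (t : ℝ) (h : Rn n) :
    Rn n :=
  t⁻¹ • (prox Λ φ (z + t • h) - prox Λ φ z)

theorem prox_add_smul_proxQuot {z h : Rn n} {t : ℝ} (ht : t ≠ 0) :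
    prox Λ φ z + t • proxQuot Λ φ z t h = prox Λ φ (z + t • h) := by
  rw [proxQuot, smul_inv_smul₀ ht, add_sub_cancel]

/-- The difference quotient of the proximity operator is a proximal point of the second-order
difference quotient. -/
theorem secondQuot_proxQuot_le (hφ : IsConvexLscProper φ) (hΛ : Λ.PosDef) (z h w : Rn n) {t : ℝ}
    (ht : 0 < t) :
    secondQuot φ (prox Λ φ z) (act Λ (z - prox Λ φ z)) t (proxQuot Λ φ z t h) +
        ((2 * inner ℝ (act Λ (h - proxQuot Λ φ z t h)) (w - proxQuot Λ φ z t h) : ℝ) : EReal) ≤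
      secondQuot φ (prox Λ φ z) (act Λ (z - prox Λ φ z)) t w := by
  obtain ⟨a, ha⟩ := hφ.exists_coe_eq (hφ.prox_ne_top hΛ z)
  obtain ⟨b, hb⟩ := hφ.exists_coe_eq (hφ.prox_ne_top hΛ (z + t • h))
  have hp := prox_add_smul_proxQuot (Λ := Λ) (φ := φ) (z := z) (h := h) ht.ne'
  rcases eq_or_ne (φ (prox Λ φ z + t • w)) ⊤ with hw | hw
  · rw [secondQuot_top ha ht hw]; exact le_top
  obtain ⟨c, hc⟩ := hφ.exists_coe_eq hw
  have key := hφ.prox_subgradient hΛ hb hc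
  rw [← hp] at hb key
  set p := proxQuot Λ φ z t h
  set x := prox Λ φ z
  rw [secondQuot_coe ha hb, secondQuot_coe ha hc, ← EReal.coe_add, EReal.coe_le_coe_iff]
  have e1 : x + t • w - (x + t • p) = t • (w - p) := by module
  have e2 : z + t • h - (x + t • p) = (z - x) + t • (h - p) := by module
  rw [e1, e2, map_add, map_smul, inner_add_left, real_inner_smul_left, real_inner_smul_right,
    real_inner_smul_right, inner_sub_right (act Λ (z - x))] at key
  rw [le_div_iff₀ (by positivity), add_mul, div_mul_cancel₀ _ (by positivity)]
  nlinarith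

theorem secondQuot_nonneg (hφ : IsConvexLscProper φ) (hΛ : Λ.PosDef) (z w : Rn n) {t : ℝ}
    (ht : 0 < t) : 0 ≤ secondQuot φ (prox Λ φ z) (act Λ (z - prox Λ φ z)) t w := by
  obtain ⟨a, ha⟩ := hφ.exists_coe_eq (hφ.prox_ne_top hΛ z)
  have h := secondQuot_proxQuot_le hφ hΛ z 0 w ht
  have hp : proxQuot Λ φ z t 0 = 0 := by simp [proxQuot]
  rw [hp, secondQuot_coe ha (b := a) (by simpa using ha)] at h
  simpa using h

theorem secondQuot_zero (hφ : IsConvexLscProper φ) (hΛ : Λ.PosDef) (z α : Rn n) (t : ℝ) :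
    secondQuot φ (prox Λ φ z) α t 0 = 0 := by
  obtain ⟨a, ha⟩ := hφ.exists_coe_eq (hφ.prox_ne_top hΛ z)
  rw [secondQuot_coe ha (b := a) (by simpa using ha)]
  simp

theorem secondQuot_smul (hφ : IsConvexLscProper φ) (hΛ : Λ.PosDef) (z α w : Rn n) {t c : ℝ}
    (ht : 0 < t) (hc : 0 < c) :
    secondQuot φ (prox Λ φ z) α t (c • w) =
      ((c ^ 2 : ℝ) : EReal) * secondQuot φ (prox Λ φ z) α (c * t) w := by
  obtain ⟨a, ha⟩ := hφ.exists_coe_eq (hφ.prox_ne_top hΛ z)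
  have e : prox Λ φ z + t • c • w = prox Λ φ z + (c * t) • w := by rw [smul_smul, mul_comm]
  rcases eq_or_ne (φ (prox Λ φ z + (c * t) • w)) ⊤ with hw | hw
  · rw [secondQuot_top ha ht (e ▸ hw), secondQuot_top ha (by positivity) hw,
      EReal.coe_mul_top_of_pos (by positivity)]
  · obtain ⟨b, hb⟩ := hφ.exists_coe_eq hw
    rw [secondQuot_coe ha (e ▸ hb), secondQuot_coe ha hb, ← EReal.coe_mul, EReal.coe_eq_coe_iff,
      real_inner_smul_right]
    field_simp

variable {d : Rn n → EReal} {z : Rn n}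

namespace IsSecondEpiDerivative

theorem nonneg (hφ : IsConvexLscProper φ) (hΛ : Λ.PosDef)
    (hd : IsSecondEpiDerivative φ (prox Λ φ z) (act Λ (z - prox Λ φ z)) d) (w : Rn n) :
    0 ≤ d w := by
  obtain ⟨s, -, hs⟩ := (hd w (fun k => 1 / ((k : ℝ) + 1)) (fun k => by positivity)
    tendsto_one_div_add_atTop_nhds_zero_nat).2
  refine le_trans ?_ hs
  refine le_limsup_of_frequently_le (Frequently.of_forall fun k => ?_)
  exact secondQuot_nonneg hφ hΛ z _ (by positivity)

theorem zero_le (hφ : IsConvexLscProper φ) (hΛ : Λ.PosDef)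
    (hd : IsSecondEpiDerivative φ (prox Λ φ z) (act Λ (z - prox Λ φ z)) d) :
    d 0 ≤ 0 := by
  have := (hd 0 (fun k => 1 / ((k : ℝ) + 1)) (fun k => by positivity)
    tendsto_one_div_add_atTop_nhds_zero_nat).1 (fun _ => 0) tendsto_const_nhds
  simpa [secondQuot_zero hφ hΛ] using this

/-- A recovery sequence for w at scale c t, multiplied by c, is admissible for c • w at scale t.
Only this inequality is needed later. -/
theorem smul_le (hφ : IsConvexLscProper φ) (hΛ : Λ.PosDef)
    (hd : IsSecondEpiDerivative φ (prox Λ φ z) (act Λ (z - prox Λ φ z)) d) (w : Rn n) {c : ℝ}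
    (hc : 0 < c) : d (c • w) ≤ ((c ^ 2 : ℝ) : EReal) * d w := by
  have hlim : Tendsto (fun k : ℕ => 1 / ((k : ℝ) + 1)) atTop (𝓝 0) :=
    tendsto_one_div_add_atTop_nhds_zero_nat
  obtain ⟨s, hs, hle⟩ := (hd w (fun k => c * (1 / ((k : ℝ) + 1))) (fun k => by positivity)
    (by simpa using hlim.const_mul c)).2
  have h1 := (hd (c • w) (fun k => 1 / ((k : ℝ) + 1)) (fun k => by positivity) hlim).1
    (fun k => c • s k) (hs.const_smul c)
  have hcc : (0 : ℝ) < c ^ 2 := by positivity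
  have h2 : (fun k : ℕ => secondQuot φ (prox Λ φ z) (act Λ (z - prox Λ φ z))
      (1 / ((k : ℝ) + 1)) (c • s k)) = fun k : ℕ => ((c ^ 2 : ℝ) : EReal) *
        secondQuot φ (prox Λ φ z) (act Λ (z - prox Λ φ z)) (c * (1 / ((k : ℝ) + 1))) (s k) := by
    funext k
    exact secondQuot_smul hφ hΛ z _ _ (by positivity) hc
  rw [h2] at h1
  refine h1.trans ((liminf_le_limsup).trans ?_)
  have h0 : (0 : EReal) ≤ ((c ^ 2 : ℝ) : EReal) := by exact_mod_cast hcc.le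
  rw [EReal.limsup_const_mul_of_nonneg_of_ne_top h0 (EReal.coe_ne_top _)]
  exact mul_le_mul_of_nonneg_left hle h0

/-- A cluster point of difference quotients of the proximity operator is a proximal point of the
second-order epi-derivative. -/
theorem add_inner_le (hφ : IsConvexLscProper φ) (hΛ : Λ.PosDef)
    (hd : IsSecondEpiDerivative φ (prox Λ φ z) (act Λ (z - prox Λ φ z)) d)
    {t : ℕ → ℝ} {s : ℕ → Rn n} {h p : Rn n} (ht : ∀ k, 0 < t k) (ht0 : Tendsto t atTop (𝓝 0))
    (hs : Tendsto s atTop (𝓝 h))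
    (hp : Tendsto (fun k => proxQuot Λ φ z (t k) (s k)) atTop (𝓝 p)) (w : Rn n) :
    d p + ((2 * inner ℝ (act Λ (h - p)) (w - p) : ℝ) : EReal) ≤ d w := by
  obtain ⟨r, hr, hle⟩ := (hd w t ht ht0).2
  have h1 := (hd p t ht ht0).1 _ hp
  have hc : Tendsto (fun k => ((2 * inner ℝ (act Λ (s k - proxQuot Λ φ z (t k) (s k)))
      (r k - proxQuot Λ φ z (t k) (s k)) : ℝ) : EReal)) atTop
      (𝓝 ((2 * inner ℝ (act Λ (h - p)) (w - p) : ℝ) : EReal)) := by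
    refine (continuous_coe_real_ereal.tendsto _).comp ?_
    exact ((((act Λ).continuous.tendsto _).comp (hs.sub hp)).inner (hr.sub hp)).const_mul 2
  calc d p + _ ≤ _ := add_le_add_left h1 _
    _ = _ := by rw [← hc.liminf_eq]
    _ ≤ _ := EReal.le_liminf_add
    _ ≤ _ := liminf_le_limsup
    _ ≤ _ := limsup_le_limsup (Eventually.of_forall fun k =>
        secondQuot_proxQuot_le hφ hΛ z (s k) (r k) (ht k))
    _ ≤ d w := hle

/-- Proximal points of `d` are unique. -/
theorem eq_of_add_inner_le (hΛ : Λ.PosDef) {h p p' : Rn n} {D D' : ℝ}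
    (hD : d p = D) (hD' : d p' = D')
    (hp : ∀ w, d p + ((2 * inner ℝ (act Λ (h - p)) (w - p) : ℝ) : EReal) ≤ d w)
    (hp' : ∀ w, d p' + ((2 * inner ℝ (act Λ (h - p')) (w - p') : ℝ) : EReal) ≤ d w) :
    p = p' := by
  have h1 := hp p'
  have h2 := hp' p
  rw [hD, hD'] at h1 h2
  norm_cast at h1 h2
  by_contra hne
  have h3 := inner_act_self_pos hΛ (sub_ne_zero.2 hne)
  rw [← inner_act_comm hΛ] at h3
  have e : act Λ (p - p') = act Λ (h - p') - act Λ (h - p) := by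
    simp only [map_sub]; abel
  rw [e, inner_sub_left] at h3
  rw [← neg_sub p p', inner_neg_right] at h1
  linarith

/-- Testing with w = 0, where d is at most 0, excludes ⊤; nonnegativity excludes ⊥. -/
theorem exists_coe_eq (hφ : IsConvexLscProper φ) (hΛ : Λ.PosDef)
    (hd : IsSecondEpiDerivative φ (prox Λ φ z) (act Λ (z - prox Λ φ z)) d) {h p : Rn n}
    (hp : ∀ w, d p + ((2 * inner ℝ (act Λ (h - p)) (w - p) : ℝ) : EReal) ≤ d w) :
    ∃ D : ℝ, d p = D := by
  have hbot : d p ≠ ⊥ := fun hb => by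
    have := hd.nonneg hφ hΛ p
    rw [hb] at this
    exact absurd this (by simp)
  have htop : d p ≠ ⊤ := fun hb => by
    have := (hp 0).trans (hd.zero_le hφ hΛ)
    rw [hb, EReal.top_add_coe] at this
    exact absurd this (by simp)
  exact ⟨_, (EReal.coe_toReal htop hbot).symm⟩

/-- Euler's identity for a function homogeneous of degree two, with 2Λ(h - p) as a subgradient of d
at p. -/
theorem eq_inner (hφ : IsConvexLscProper φ) (hΛ : Λ.PosDef)
    (hd : IsSecondEpiDerivative φ (prox Λ φ z) (act Λ (z - prox Λ φ z)) d) {h p : Rn n}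
    (hp : ∀ w, d p + ((2 * inner ℝ (act Λ (h - p)) (w - p) : ℝ) : EReal) ≤ d w) :
    d p = ((inner ℝ (act Λ (h - p)) p : ℝ) : EReal) := by
  obtain ⟨D, hD⟩ := hd.exists_coe_eq hφ hΛ hp
  set b := inner ℝ (act Λ (h - p)) p with hb
  -- Test with w = (1 + e)p; dividing by e of either sign and letting e → 0 gives both inequalities.
  have key : ∀ e : ℝ, -1 < e → 2 * e * b ≤ (2 * e + e ^ 2) * D := by
    intro e he
    have h1 := (hp ((1 + e) • p)).trans (hd.smul_le hφ hΛ p (by linarith))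
    rw [hD] at h1
    norm_cast at h1
    have e1 : (1 + e) • p - p = e • p := by module
    rw [e1, real_inner_smul_right, ← hb] at h1
    linarith
  have hlim : Tendsto (fun e : ℝ => e * D / 2) (𝓝[>] 0) (𝓝 0) := by
    have : Continuous fun e : ℝ => e * D / 2 := by fun_prop
    simpa using (this.tendsto 0).mono_left nhdsWithin_le_nhds
  rw [hD, EReal.coe_eq_coe_iff]
  have hu : b - D ≤ 0 := by
    refine ge_of_tendsto hlim ?_
    filter_upwards [self_mem_nhdsWithin] with e (he : 0 < e)
    have := key e (by linarith)
    have : e * (2 * b) ≤ e * ((2 + e) * D) := by nlinarith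
    have := le_of_mul_le_mul_left this he
    linarith
  have hl : D - b ≤ 0 := by
    refine ge_of_tendsto hlim ?_
    filter_upwards [Ioo_mem_nhdsGT (zero_lt_one' ℝ)] with e he
    have := key (-e) (by linarith [he.2])
    have : e * ((2 - e) * D) ≤ e * (2 * b) := by nlinarith
    have := le_of_mul_le_mul_left this he.1
    linarith
  linarith

end IsSecondEpiDerivative

theorem norm_proxQuot_le {K : NNReal} (hK : LipschitzWith K (prox Λ φ)) (z h : Rn n) (t : ℝ) :
    ‖proxQuot Λ φ z t h‖ ≤ K * ‖h‖ := by
  rcases eq_or_ne t 0 with rfl | ht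
  · simp only [proxQuot, inv_zero, zero_smul, norm_zero]; positivity
  · have := hK.dist_le_mul (z + t • h) z
    rw [dist_eq_norm, dist_eq_norm, add_sub_cancel_left, norm_smul] at this
    rw [proxQuot, norm_smul, norm_inv, inv_mul_le_iff₀ (norm_pos_iff.2 ht)]
    linarith

theorem exists_subseq_tendsto_proxQuot (hφ : IsConvexLscProper φ) (hΛ : Λ.PosDef)
    (z : Rn n) (t : ℕ → ℝ) {s : ℕ → Rn n} {h : Rn n} (hs : Tendsto s atTop (𝓝 h)) :
    ∃ p, ∃ ψ : ℕ → ℕ, StrictMono ψ ∧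
      Tendsto (fun k => proxQuot Λ φ z (t (ψ k)) (s (ψ k))) atTop (𝓝 p) := by
  obtain ⟨K, hK⟩ := hφ.exists_lipschitzWith_prox hΛ
  obtain ⟨M, hM⟩ := (Metric.isBounded_range_of_tendsto s hs).exists_norm_le
  obtain ⟨p, -, ψ, hψ, hp⟩ := (isCompact_closedBall (0 : Rn n) (K * M)).tendsto_subseq
    (x := fun k => proxQuot Λ φ z (t k) (s k)) fun k => by
      rw [mem_closedBall_zero_iff]
      exact (norm_proxQuot_le hK z _ _).trans (by gcongr; exact hM _ ⟨k, rfl⟩)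
  exact ⟨p, ψ, hψ, hp⟩

/-- The proximity operator of a twice epi-differentiable function is semidifferentiable. -/
theorem IsSecondEpiDerivative.exists_tendsto_proxQuot (hφ : IsConvexLscProper φ) (hΛ : Λ.PosDef)
    (hd : IsSecondEpiDerivative φ (prox Λ φ z) (act Λ (z - prox Λ φ z)) d) (h : Rn n) :
    ∃ v, (∀ w, d v + ((2 * inner ℝ (act Λ (h - v)) (w - v) : ℝ) : EReal) ≤ d w) ∧
      Tendsto (fun q : ℝ × Rn n => proxQuot Λ φ z q.1 q.2) (𝓝[>] 0 ×ˢ 𝓝 h) (𝓝 v) := by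
  have hlim : Tendsto (fun k : ℕ => 1 / ((k : ℝ) + 1)) atTop (𝓝 0) :=
    tendsto_one_div_add_atTop_nhds_zero_nat
  obtain ⟨v, ψ, hψ, hv⟩ := exists_subseq_tendsto_proxQuot hφ hΛ z
    (fun k : ℕ => 1 / ((k : ℝ) + 1)) (tendsto_const_nhds (x := h))
  have hpos : ∀ k : ℕ, 0 < 1 / ((ψ k : ℝ) + 1) := fun k => by positivity
  have hvd := hd.add_inner_le hφ hΛ hpos (hlim.comp hψ.tendsto_atTop)
    tendsto_const_nhds hv
  obtain ⟨D, hD⟩ := hd.exists_coe_eq hφ hΛ hvd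
  refine ⟨v, hvd, tendsto_of_subseq_tendsto fun q hq => ?_⟩
  have h1 : Tendsto (fun k => (q k).1) atTop (𝓝[>] 0) := tendsto_fst.comp hq
  have h2 : Tendsto (fun k => (q k).2) atTop (𝓝 h) := tendsto_snd.comp hq
  rw [tendsto_nhdsWithin_iff] at h1
  obtain ⟨N, hN⟩ := eventually_atTop.1 h1.2
  -- The step sizes are only eventually positive, so the sequence is shifted by N.
  have hadd : Tendsto (fun k : ℕ => k + N) atTop atTop := tendsto_add_atTop_nat N
  obtain ⟨p, χ, hχ, hp⟩ := exists_subseq_tendsto_proxQuot hφ hΛ z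
    (fun k => (q (k + N)).1) (h2.comp hadd)
  have hpd := hd.add_inner_le hφ hΛ (fun k => hN (χ k + N) (Nat.le_add_left _ _))
    (h1.1.comp (hadd.comp hχ.tendsto_atTop)) (h2.comp (hadd.comp hχ.tendsto_atTop)) hp
  obtain ⟨D', hD'⟩ := hd.exists_coe_eq hφ hΛ hpd
  refine ⟨fun k => χ k + N, ?_⟩
  rw [eq_of_add_inner_le hΛ hD hD' hvd hpd]
  exact hp

end NormalMap

/-! ### Taylor expansion, quadratic growth and the derivative of the normal map. -/

namespace NormalMap

variable {n : ℕ} {Λ : Matrix (Fin n) (Fin n) ℝ} {φ : Rn n → EReal} {f : Rn n → ℝ}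

theorem hasFDerivAt_gradient {x : Rn n} (hf : ContDiffAt ℝ 2 f x) :
    HasFDerivAt (gradient f) (hessian f x) x := by
  have h1 : ContDiffAt ℝ 1 (fderiv ℝ f) x := hf.fderiv_right (by norm_num)
  have h2 : DifferentiableAt ℝ (fderiv ℝ f) x := h1.differentiableAt one_ne_zero
  have h3 : DifferentiableAt ℝ (gradient f) x :=
    (InnerProductSpace.toDual ℝ (Rn n)).symm.differentiable.differentiableAt.comp x h2
  exact h3.hasFDerivAt

/-- Second-order Taylor expansion with Peano remainder. -/
theorem taylor_second_isLittleO (hf : Differentiable ℝ f) {x : Rn n} {H : Rn n →L[ℝ] Rn n}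
    (hH : HasFDerivAt (gradient f) H x) :
    (fun u => f (x + u) - f x - inner ℝ (gradient f x) u - 1 / 2 * inner ℝ u (H u))
      =o[𝓝 0] fun u => ‖u‖ ^ 2 := by
  rw [Asymptotics.isLittleO_iff]
  intro ε hε
  have h1 := hasFDerivAt_iff_isLittleO_nhds_zero.1 hH
  rw [Asymptotics.isLittleO_iff] at h1
  obtain ⟨δ, hδ, hball⟩ := Metric.eventually_nhds_iff_ball.1 (h1 hε)
  filter_upwards [Metric.ball_mem_nhds (0 : Rn n) hδ] with u hu
  rw [mem_ball_zero_iff] at hu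
  have hderiv : ∀ s : ℝ, HasDerivAt
      (fun s : ℝ => f (x + s • u) - s * inner ℝ (gradient f x) u - s ^ 2 / 2 * inner ℝ u (H u))
      (inner ℝ (gradient f (x + s • u) - gradient f x - H (s • u)) u) s := by
    intro s
    have hl : HasDerivAt (fun s : ℝ => x + s • u) u s := by
      simpa using ((hasDerivAt_id s).smul_const u).const_add x
    have hc := (hf (x + s • u)).hasFDerivAt.comp_hasDerivAt s hl
    rw [← inner_gradient_left] at hc
    have h2 : HasDerivAt (fun s : ℝ => s * inner ℝ (gradient f x) u)
        (inner ℝ (gradient f x) u) s := by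
      simpa using (hasDerivAt_id s).mul_const (inner ℝ (gradient f x) u)
    have h3 : HasDerivAt (fun s : ℝ => s ^ 2 / 2 * inner ℝ u (H u)) (s * inner ℝ u (H u)) s := by
      have := (((hasDerivAt_id s).pow 2).div_const 2).mul_const (inner ℝ u (H u))
      simpa using this
    refine ((hc.sub h2).sub h3).congr_deriv ?_
    rw [inner_sub_left, inner_sub_left, map_smul, real_inner_smul_left, real_inner_comm u (H u)]
  -- The remainder along s ↦ x + s • u has derivative at most ε‖u‖² on [0, 1], by differentiability
  -- of the gradient at x alone.
  have hmv := norm_image_sub_le_of_norm_deriv_le_segment_01' (C := ε * ‖u‖ ^ 2)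
    (fun s _ => (hderiv s).hasDerivWithinAt) (fun s hs => by
      have hsu : ‖s • u‖ ≤ ‖u‖ := by
        rw [norm_smul, Real.norm_of_nonneg hs.1]
        exact mul_le_of_le_one_left (norm_nonneg _) hs.2.le
      have h4 := hball (s • u) (by rw [mem_ball_zero_iff]; exact hsu.trans_lt hu)
      calc ‖inner ℝ (gradient f (x + s • u) - gradient f x - H (s • u)) u‖
          ≤ ‖gradient f (x + s • u) - gradient f x - H (s • u)‖ * ‖u‖ := norm_inner_le_norm _ _
        _ ≤ (ε * ‖s • u‖) * ‖u‖ := by gcongr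
        _ ≤ (ε * ‖u‖) * ‖u‖ := by gcongr
        _ = ε * ‖u‖ ^ 2 := by ring)
  rw [norm_pow, norm_norm]
  refine le_of_eq_of_le (congrArg _ ?_) hmv
  simp only [one_smul, zero_smul, add_zero]
  ring

theorem tendsto_taylor_second (hf : Differentiable ℝ f) {x : Rn n} {H : Rn n →L[ℝ] Rn n}
    (hH : HasFDerivAt (gradient f) H x) {t : ℕ → ℝ} {p : ℕ → Rn n} {v : Rn n}
    (ht : ∀ k, 0 < t k) (ht0 : Tendsto t atTop (𝓝 0)) (hp : Tendsto p atTop (𝓝 v)) :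
    Tendsto (fun k => (f (x + t k • p k) - f x - t k * inner ℝ (gradient f x) (p k)) /
      (t k ^ 2 / 2)) atTop (𝓝 (inner ℝ v (H v))) := by
  have hu : Tendsto (fun k => t k • p k) atTop (𝓝 0) := by simpa using ht0.smul hp
  have h1 := (taylor_second_isLittleO hf hH).comp_tendsto hu
  have h2 : (fun k => ‖t k • p k‖ ^ 2) =O[atTop] fun k => t k ^ 2 := by
    have : (fun k => ‖t k • p k‖ ^ 2) = fun k => ‖p k‖ ^ 2 * t k ^ 2 := by
      funext k
      rw [norm_smul, Real.norm_of_nonneg (ht k).le]; ring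
    rw [this]
    have hb : (fun k => ‖p k‖ ^ 2) =O[atTop] fun _ => (1 : ℝ) := (hp.norm.pow 2).isBigO_one ℝ
    simpa using hb.mul (Asymptotics.isBigO_refl (fun k => t k ^ 2) atTop)
  have h3 := ((h1.trans_isBigO h2).tendsto_div_nhds_zero).const_mul 2
  have h4 : Tendsto (fun k => inner ℝ (p k) (H (p k))) atTop (𝓝 (inner ℝ v (H v))) :=
    hp.inner ((H.continuous.tendsto v).comp hp)
  have h5 := h3.add h4
  rw [mul_zero, zero_add] at h5
  refine h5.congr fun k => ?_
  have := (ht k).ne'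
  simp only [Function.comp_apply, map_smul, real_inner_smul_left, real_inner_smul_right]
  field_simp
  ring

/-- Quadratic growth of `ψ ∘ prox` yields a lower bound for the second-order form. -/
theorem mul_inner_le_of_growth (hφ : IsConvexLscProper φ) (hΛ : Λ.PosDef)
    (hf : Differentiable ℝ f) {z : Rn n} {H : Rn n →L[ℝ] Rn n}
    (hH : HasFDerivAt (gradient f) H (prox Λ φ z))
    (hα : act Λ (z - prox Λ φ z) = -gradient f (prox Λ φ z)) {d : Rn n → EReal}
    (hd : IsSecondEpiDerivative φ (prox Λ φ z) (act Λ (z - prox Λ φ z)) d) {σ : ℝ}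
    (hσ : ∀ᶠ y in 𝓝 z, objective f φ (prox Λ φ z) +
        ((σ / 2 * wnorm Λ (prox Λ φ y - prox Λ φ z) ^ 2 : ℝ) : EReal) ≤
      objective f φ (prox Λ φ y)) {h v : Rn n}
    (hvd : ∀ w, d v + ((2 * inner ℝ (act Λ (h - v)) (w - v) : ℝ) : EReal) ≤ d w)
    (hv : Tendsto (fun q : ℝ × Rn n => proxQuot Λ φ z q.1 q.2) (𝓝[>] 0 ×ˢ 𝓝 h) (𝓝 v)) :
    σ * inner ℝ v (act Λ v) ≤ inner ℝ v (H v + act Λ (h - v)) := by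
  have hlim : Tendsto (fun k : ℕ => 1 / ((k : ℝ) + 1)) atTop (𝓝 0) :=
    tendsto_one_div_add_atTop_nhds_zero_nat
  set t : ℕ → ℝ := fun k => 1 / ((k : ℝ) + 1) with ht
  have htpos : ∀ k, 0 < t k := fun k => by positivity
  have hp : Tendsto (fun k => proxQuot Λ φ z (t k) h) atTop (𝓝 v) := by
    refine hv.comp (Tendsto.prodMk ?_ tendsto_const_nhds)
    exact tendsto_nhdsWithin_iff.2 ⟨hlim, Eventually.of_forall htpos⟩
  -- The upper bound by d v is available only along a recovery sequence r, not along the prox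
  -- quotients p; the proximal inequality transfers the growth estimate from p to r, at a cost that
  -- vanishes because both tend to v.
  obtain ⟨r, hr, hle⟩ := (hd v t htpos hlim).2
  set p : ℕ → Rn n := fun k => proxQuot Λ φ z (t k) h with hpdef
  set e : ℕ → ℝ := fun k => (f (prox Λ φ z + t k • p k) - f (prox Λ φ z) -
    t k * inner ℝ (gradient f (prox Λ φ z)) (p k)) / (t k ^ 2 / 2) with he
  set a : ℕ → ℝ := fun k => σ * inner ℝ (p k) (act Λ (p k)) - e k +
    2 * inner ℝ (act Λ (h - p k)) (r k - p k) with ha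
  have hlima : Tendsto a atTop (𝓝 (σ * inner ℝ v (act Λ v) - inner ℝ v (H v))) := by
    have h1 : Tendsto (fun k => inner ℝ (p k) (act Λ (p k))) atTop (𝓝 (inner ℝ v (act Λ v))) :=
      hp.inner (((act Λ).continuous.tendsto v).comp hp)
    have h2 := tendsto_taylor_second hf hH htpos hlim hp
    have h3 : Tendsto (fun k => inner ℝ (act Λ (h - p k)) (r k - p k)) atTop
        (𝓝 (inner ℝ (act Λ (h - v)) (v - v))) :=
      (((act Λ).continuous.tendsto _).comp (tendsto_const_nhds.sub hp)).inner (hr.sub hp)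
    rw [sub_self, inner_zero_right] at h3
    have := ((h1.const_mul σ).sub h2).add (h3.const_mul 2)
    rwa [mul_zero, add_zero] at this
  have hz : Tendsto (fun k => z + t k • h) atTop (𝓝 z) := by
    simpa using (hlim.smul_const h).const_add z
  have hev : ∀ᶠ k in atTop, ((a k : ℝ) : EReal) ≤
      secondQuot φ (prox Λ φ z) (act Λ (z - prox Λ φ z)) (t k) (r k) := by
    filter_upwards [hz.eventually hσ] with k hk
    refine le_trans ?_ (secondQuot_proxQuot_le hφ hΛ z h (r k) (htpos k))
    obtain ⟨b, hb⟩ := hφ.exists_coe_eq (hφ.prox_ne_top hΛ z)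
    obtain ⟨c, hc⟩ := hφ.exists_coe_eq (hφ.prox_ne_top hΛ (z + t k • h))
    have hpk := prox_add_smul_proxQuot (Λ := Λ) (φ := φ) (z := z) (h := h) (htpos k).ne'
    rw [← hpk] at hc hk
    rw [secondQuot_coe hb hc, ha, EReal.coe_add]
    refine add_le_add_left ?_ _
    rw [EReal.coe_le_coe_iff, le_div_iff₀ (by have := htpos k; positivity), sub_mul, he,
      div_mul_cancel₀ _ (by have := htpos k; positivity), hα, inner_neg_left]
    rw [objective, objective, hb, hc, add_sub_cancel_left, wnorm_sq hΛ, map_smul,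
      real_inner_smul_left, real_inner_smul_right] at hk
    norm_cast at hk
    simp only [hpdef]
    linarith
  have hD := hd.eq_inner hφ hΛ hvd
  have hfin : ((σ * inner ℝ v (act Λ v) - inner ℝ v (H v) : ℝ) : EReal) ≤ d v := by
    refine le_trans ?_ hle
    rw [← ((continuous_coe_real_ereal.tendsto _).comp hlima).limsup_eq]
    exact limsup_le_limsup hev
  rw [hD, EReal.coe_le_coe_iff, real_inner_comm v (act Λ (h - v))] at hfin
  rw [inner_add_right]
  linarith

/-- Chain rule: the gradient is differentiated along the increments t • `proxQuot` of prox, and the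
remaining part is linear. -/
theorem tendsto_normalMap_quot {z h v : Rn n} {H : Rn n →L[ℝ] Rn n}
    (hH : HasFDerivAt (gradient f) H (prox Λ φ z))
    {ι : Type*} {l : Filter ι} {t : ι → ℝ} {s : ι → Rn n} (ht : ∀ᶠ k in l, t k ≠ 0)
    (ht0 : Tendsto t l (𝓝 0)) (hs : Tendsto s l (𝓝 h))
    (hv : Tendsto (fun k => proxQuot Λ φ z (t k) (s k)) l (𝓝 v)) :
    Tendsto (fun k => (t k)⁻¹ • (normalMap Λ f φ (z + t k • s k) - normalMap Λ f φ z)) l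
      (𝓝 (H v + act Λ (h - v))) := by
  have hdl : Tendsto (fun k => t k • proxQuot Λ φ z (t k) (s k)) l (𝓝 0) := by
    simpa using ht0.smul hv
  have h1 := hH.hasFDerivWithinAt (s := Set.univ) |>.lim (c := fun k => (t k)⁻¹) hdl
    (Eventually.of_forall fun _ => Set.mem_univ _)
    (hv.congr' (ht.mono fun k hk => (inv_smul_smul₀ hk _).symm))
  have h2 := ((act Λ).continuous.tendsto _).comp (hs.sub hv)
  refine (h1.add h2).congr' (ht.mono fun k hk => ?_)
  have hp := prox_add_smul_proxQuot (Λ := Λ) (φ := φ) (z := z) (h := s k) hk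
  simp only [Function.comp_apply, normalMap]
  rw [← hp]
  set p := proxQuot Λ φ z (t k) (s k)
  have e : z + t k • s k - (prox Λ φ z + t k • p) =
      (z - prox Λ φ z) + t k • (s k - p) := by module
  rw [e, map_add, map_smul, add_sub_add_comm, smul_add, add_sub_cancel_left, inv_smul_smul₀ hk]

theorem dirDeriv_eq {F : Rn n → Rn n} {x h v : Rn n}
    (hv : Tendsto (fun q : ℝ × Rn n => q.1⁻¹ • (F (x + q.1 • q.2) - F x))
      (𝓝[>] 0 ×ˢ 𝓝 h) (𝓝 v)) : dirDeriv F x h = v :=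
  (hv.comp (tendsto_id.prodMk tendsto_const_nhds)).limUnder_eq

/-! ### Strong metric subregularity. -/

/-- A sequential criterion for strong metric subregularity. -/
theorem stronglyMetricallySubregularAt_of_seq {F : Rn n → Rn n} {ξ : Rn n} (hF : F ξ = 0)
    (hseq : ∀ (t : ℕ → ℝ) (s : ℕ → Rn n) (h : Rn n), (∀ k, 0 < t k) → Tendsto t atTop (𝓝 0) →
      Tendsto s atTop (𝓝 h) →
      Tendsto (fun k => (t k)⁻¹ • F (ξ + t k • s k)) atTop (𝓝 0) → h = 0) :
    StronglyMetricallySubregularAt F ξ 0 := by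
  refine ⟨hF, ?_⟩
  by_contra! hcon
  choose x hx hlt using fun k : ℕ => hcon ((k : ℝ) + 1) (by positivity)
    (Metric.ball ξ (1 / ((k : ℝ) + 1))) (Metric.ball_mem_nhds _ (by positivity))
  simp only [dist_zero_left] at hlt
  set t : ℕ → ℝ := fun k => ‖x k - ξ‖ with ht
  have htpos : ∀ k, 0 < t k := fun k => lt_of_le_of_lt (by positivity) (hlt k)
  have ht0 : Tendsto t atTop (𝓝 0) :=
    squeeze_zero (fun k => (htpos k).le) (fun k => (mem_ball_iff_norm.1 (hx k)).le)
      tendsto_one_div_add_atTop_nhds_zero_nat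
  -- Normalized violations accumulate at a unit direction h, which `hseq` forces to be zero.
  obtain ⟨h, hh, ψ, hψ, hs⟩ := (isCompact_sphere (0 : Rn n) 1).tendsto_subseq
    (x := fun k => (t k)⁻¹ • (x k - ξ)) fun k => by
      rw [mem_sphere_zero_iff_norm, norm_smul, norm_inv, Real.norm_of_nonneg (htpos k).le]
      exact inv_mul_cancel₀ (htpos k).ne'
  have h0 : Tendsto (fun k => (t k)⁻¹ • F (x k)) atTop (𝓝 0) := by
    refine squeeze_zero_norm (fun k => ?_) tendsto_one_div_add_atTop_nhds_zero_nat
    rw [norm_smul, norm_inv, Real.norm_of_nonneg (htpos k).le, inv_mul_le_iff₀ (htpos k),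
      mul_one_div, le_div_iff₀ (by positivity), mul_comm]
    exact (hlt k).le
  have := hseq (t ∘ ψ) _ h (fun k => htpos _) (ht0.comp hψ.tendsto_atTop) hs (by
    refine (h0.comp hψ.tendsto_atTop).congr fun k => ?_
    simp only [Function.comp_apply]
    rw [smul_inv_smul₀ (htpos _).ne', add_sub_cancel])
  simp [this] at hh

/-- The second-order sufficient condition implies strong metric subregularity of the normal map. -/
theorem stronglyMetricallySubregularAt_normalMap (hΛ : Λ.PosDef) {z : Rn n}
    {H : Rn n →L[ℝ] Rn n} (hH : HasFDerivAt (gradient f) H (prox Λ φ z))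
    (hz : normalMap Λ f φ z = 0) {v : Rn n → Rn n}
    (hv : ∀ h, Tendsto (fun q : ℝ × Rn n => proxQuot Λ φ z q.1 q.2) (𝓝[>] 0 ×ˢ 𝓝 h) (𝓝 (v h)))
    (hpos : ∀ h, v h ≠ 0 → 0 < inner ℝ (v h) (H (v h) + act Λ (h - v h))) :
    StronglyMetricallySubregularAt (normalMap Λ f φ) z 0 := by
  refine stronglyMetricallySubregularAt_of_seq hz fun t s h ht ht0 hs hF => ?_
  have hq : Tendsto (fun k => (t k, s k)) atTop (𝓝[>] 0 ×ˢ 𝓝 h) :=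
    Tendsto.prodMk (tendsto_nhdsWithin_iff.2 ⟨ht0, Eventually.of_forall ht⟩) hs
  have h1 := tendsto_normalMap_quot hH (Eventually.of_forall fun k => (ht k).ne') ht0 hs
    ((hv h).comp hq)
  simp only [hz, sub_zero] at h1
  have h2 := tendsto_nhds_unique h1 hF
  have h3 : v h = 0 := by
    by_contra hne
    have := hpos h hne
    rw [h2, inner_zero_right] at this
    exact lt_irrefl _ this
  rw [h3, map_zero, zero_add, sub_zero] at h2
  rw [← act_inv_act hΛ h, h2, map_zero]

/-- The second-order sufficient condition implies strong metric subregularity of the natural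
residual. -/
theorem stronglyMetricallySubregularAt_natRes (hΛ : Λ.PosDef) {x z : Rn n}
    {H : Rn n →L[ℝ] Rn n} (hH : HasFDerivAt (gradient f) H x)
    (hx : natRes Λ f φ x = 0) (hxz : x - act Λ⁻¹ (gradient f x) = z) {v : Rn n → Rn n}
    (hv : ∀ h, Tendsto (fun q : ℝ × Rn n => proxQuot Λ φ z q.1 q.2) (𝓝[>] 0 ×ˢ 𝓝 h) (𝓝 (v h)))
    (hpos : ∀ h, v h ≠ 0 → 0 < inner ℝ (v h) (H (v h) + act Λ (h - v h))) :
    StronglyMetricallySubregularAt (natRes Λ f φ) x 0 := by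
  refine stronglyMetricallySubregularAt_of_seq hx fun t s h ht ht0 hs hF => ?_
  have hdl : Tendsto (fun k => t k • s k) atTop (𝓝 0) := by simpa using ht0.smul hs
  have hgrad := hH.hasFDerivWithinAt (s := Set.univ) |>.lim (c := fun k => (t k)⁻¹) hdl
    (Eventually.of_forall fun _ => Set.mem_univ _)
    (hs.congr fun k => (inv_smul_smul₀ (ht k).ne' _).symm)
  have hdir := hs.sub (((act Λ⁻¹).continuous.tendsto _).comp hgrad)
  -- The directional derivative of x - Λ⁻¹∇f(x) along h. A vanishing residual derivative means v g =
  -- h, and then H h + Λ(g - h) = 0, so (*) at g fails unless h = 0.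
  set g : Rn n := h - act Λ⁻¹ (H h) with hg
  have hq : Tendsto (fun k => (t k, s k - act Λ⁻¹ ((t k)⁻¹ •
      (gradient f (x + t k • s k) - gradient f x)))) atTop (𝓝[>] 0 ×ˢ 𝓝 g) :=
    Tendsto.prodMk (tendsto_nhdsWithin_iff.2 ⟨ht0, Eventually.of_forall ht⟩) hdir
  have h1 := hs.sub ((hv g).comp hq)
  have hxp : x = prox Λ φ z := by
    rw [natRes, hxz] at hx
    exact sub_eq_zero.1 hx
  have h2 : v g = h := by
    refine (sub_eq_zero.1 (tendsto_nhds_unique (h1.congr fun k => ?_) hF)).symm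
    simp only [Function.comp_apply, proxQuot, natRes]
    have e : z + t k • (s k - act Λ⁻¹ ((t k)⁻¹ • (gradient f (x + t k • s k) - gradient f x))) =
        x + t k • s k - act Λ⁻¹ (gradient f (x + t k • s k)) := by
      rw [smul_sub, ← map_smul, smul_inv_smul₀ (ht k).ne', map_sub, ← hxz]; abel
    rw [e, ← hxp, smul_sub, smul_sub, smul_add, inv_smul_smul₀ (ht k).ne']; abel
  by_contra hne
  have h3 := hpos g (h2 ▸ hne)
  rw [h2, hg, sub_sub_cancel_left, map_neg, act_act_inv hΛ, add_neg_cancel, inner_zero_right] at h3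
  exact lt_irrefl _ h3

end NormalMap

/-! ### The main theorem. -/

theorem mainTheorem6 {n : ℕ}
    (Λ : Matrix (Fin n) (Fin n) ℝ) (hΛ : Λ.PosDef)
    (f : Rn n → ℝ) (hf : ContDiff ℝ 1 f)
    (φ : Rn n → EReal) (hφ : IsConvexLscProper φ)
    (xbar zbar : Rn n) (hcrit : IsCriticalityPair Λ f φ xbar zbar)
    (hE1 : TwiceEpiDifferentiableAt φ xbar (-gradient f xbar))
    (U : Set (Rn n)) (hU : IsOpen U) (hxU : xbar ∈ U) (hf2 : ContDiffOn ℝ 2 f U) :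
    -- the directional derivatives in the claim exist
    (SemidifferentiableAt (prox Λ φ) zbar ∧ SemidifferentiableAt (normalMap Λ f φ) zbar) ∧
    -- (i) second-order necessary condition
    (IsLocalMin (fun z => objective f φ (prox Λ φ z)) zbar →
      ∀ h : Rn n,
        (∃ m : ℝ,
          IsGreatest
            ((fun D : Rn n →L[ℝ] Rn n =>
                inner ℝ (D h) (hessian f (prox Λ φ zbar) (D h) + act Λ (h - D h))) ''
              clarkeJacobian (prox Λ φ) zbar) m ∧
          inner ℝ (dirDeriv (prox Λ φ) zbar h) (dirDeriv (normalMap Λ f φ) zbar h) ≤ m) ∧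
        0 ≤ inner ℝ (dirDeriv (prox Λ φ) zbar h) (dirDeriv (normalMap Λ f φ) zbar h)) ∧
    -- (ii) quadratic growth implies the second-order sufficient condition
    ((∃ σ > (0 : ℝ), ∃ δ > (0 : ℝ), ∀ z ∈ Metric.ball zbar δ,
        objective f φ (prox Λ φ zbar) +
            ((σ / 2 * wnorm Λ (prox Λ φ z - prox Λ φ zbar) ^ 2 : ℝ) : EReal) ≤
          objective f φ (prox Λ φ z)) →
      ∀ h : Rn n, dirDeriv (prox Λ φ) zbar h ≠ 0 →
        0 < inner ℝ (dirDeriv (prox Λ φ) zbar h) (dirDeriv (normalMap Λ f φ) zbar h)) ∧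
    -- the second-order sufficient condition implies strong metric subregularity
    ((∀ h : Rn n, dirDeriv (prox Λ φ) zbar h ≠ 0 →
        0 < inner ℝ (dirDeriv (prox Λ φ) zbar h) (dirDeriv (normalMap Λ f φ) zbar h)) →
      StronglyMetricallySubregularAt (normalMap Λ f φ) zbar 0 ∧
      StronglyMetricallySubregularAt (natRes Λ f φ) xbar 0) := by
  obtain ⟨d, hd⟩ := hE1
  have hfd : Differentiable ℝ f := hf.differentiable one_ne_zero
  obtain ⟨hdom, hnat, hnor, hxz⟩ := hcrit
  have hH : HasFDerivAt (gradient f) (hessian f xbar) xbar :=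
    hasFDerivAt_gradient (hf2.contDiffAt (hU.mem_nhds hxU))
  have hα : act Λ (zbar - xbar) = -gradient f xbar := by
    rw [normalMap, ← hxz] at hnor
    exact eq_neg_of_add_eq_zero_right hnor
  have hinv : xbar - act Λ⁻¹ (gradient f xbar) = zbar := by
    rw [← neg_eq_iff_eq_neg.2 hα, map_neg, act_inv_act hΛ]; abel
  subst hxz
  have hd' : IsSecondEpiDerivative φ (prox Λ φ zbar) (act Λ (zbar - prox Λ φ zbar)) d := by
    rw [hα]; exact hd
  choose v hvd hv using fun h => hd'.exists_tendsto_proxQuot hφ hΛ h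
  have hnv : ∀ h, Tendsto (fun q : ℝ × Rn n =>
      q.1⁻¹ • (normalMap Λ f φ (zbar + q.1 • q.2) - normalMap Λ f φ zbar)) (𝓝[>] 0 ×ˢ 𝓝 h)
      (𝓝 (hessian f (prox Λ φ zbar) (v h) + act Λ (h - v h))) := fun h => by
    have ht : Tendsto (fun q : ℝ × Rn n => q.1) (𝓝[>] 0 ×ˢ 𝓝 h) (𝓝[>] 0) := tendsto_fst
    refine tendsto_normalMap_quot hH ?_ (tendsto_nhdsWithin_iff.1 ht).1 tendsto_snd (hv h)
    exact (tendsto_nhdsWithin_iff.1 ht).2.mono fun q hq => ne_of_gt hq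
  have hpd : ∀ h, dirDeriv (prox Λ φ) zbar h = v h := fun h => dirDeriv_eq (hv h)
  have hnd : ∀ h, dirDeriv (normalMap Λ f φ) zbar h =
      hessian f (prox Λ φ zbar) (v h) + act Λ (h - v h) := fun h => dirDeriv_eq (hnv h)
  simp only [hpd, hnd]
  refine ⟨⟨fun h => ⟨_, hv h⟩, fun h => ⟨_, hnv h⟩⟩, ?_, ?_, ?_⟩
  · intro hmin h
    constructor
    · obtain ⟨K, hK⟩ := hφ.exists_lipschitzWith_prox hΛ
      obtain ⟨D, hD, hDv⟩ := exists_mem_clarkeJacobian_apply_eq hK (x := zbar) (h := h)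
        ((hv h).comp (tendsto_id.prodMk tendsto_const_nhds))
      have hcont : Continuous fun D : Rn n →L[ℝ] Rn n =>
          inner ℝ (D h) (hessian f (prox Λ φ zbar) (D h) + act Λ (h - D h)) := by
        fun_prop
      obtain ⟨m, hm⟩ := ((isCompact_clarkeJacobian hK zbar).image hcont).exists_isGreatest
        ⟨_, D, hD, rfl⟩
      refine ⟨m, hm, ?_⟩
      have := hm.2 ⟨D, hD, rfl⟩
      simpa only [hDv] using this
    -- A local minimum is quadratic growth with constant zero.
    · have := mul_inner_le_of_growth hφ hΛ hfd hH hα hd' (σ := 0)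
        (hmin.mono fun y hy => by simpa using hy) (hvd h) (hv h)
      simpa using this
  · rintro ⟨σ, hσ, δ, hδ, hgrowth⟩ h hne
    exact (mul_pos hσ (inner_act_self_pos hΛ hne)).trans_le
      (mul_inner_le_of_growth hφ hΛ hfd hH hα hd'
        (eventually_of_mem (Metric.ball_mem_nhds zbar hδ) hgrowth) (hvd h) (hv h))
  · intro hpos
    exact ⟨stronglyMetricallySubregularAt_normalMap hΛ hH hnor hv hpos,
      stronglyMetricallySubregularAt_natRes hΛ hH hnat hinv hv hpos⟩
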